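/- Let $G$ be a finite connected bipartite graph (simple, with at least one edge) with color classes $V$ (violet nodes) and $E$ (emerald nodes), equipped with a ribbon structure (a cyclic permutation of the edges incident to each node), a base node $b_0$, and a base edge $b_0b_1$ incident to it. For a subgraph $H$ of $G$ and an edge $xy$ of $H$, let $xy^+_H$ denote the edge following $xy$ in the cyclic order at $x$ restricted to the edges of $H$. *Hypertrees.* For $A\in\{V,E\}$, a hypertree on $A$ in a graph $H$ on the node set of $G$ is a vector $\mathbf f\colon A\to\mathbf Z_{\ge 0}$ such that some spanning tree of $H$ has degree $\mathbf f(a)+1$ at each $a\in A$. *Bernardi processes.* Let $A,C\in\{V,E\}$ and let $\mathbf f$ be a hypertree on $A$ in $G$. The (ht:$A$, cut:$C$) Bernardi process on $\mathbf f$ maintains a current graph, initially $G$, and a current edge. If $b_0\in C$, the first current edge is $b_0b_1$; otherwise it is $b_1b_{0\,G}^{+}$, and $b_0b_1$ counts as traversed from the direction of $b_0$. In each step, let $H$ be the current graph and $cd$ the current edge, with $c\in C$. If $\mathbf f$ is a hypertree on $A$ in $H-cd$, then the next current graph is $H-cd$ and the next current edge is $cd^+_H$. Otherwise, letting $dw=dc^+_H$,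 the edge $cd$ is traversed from the direction of $c$, $dw$ is traversed from the direction of $d$, the current graph remains $H$, and the next current edge is $wd^+_H$. The process stops right before an edge would be traversed for the second time from the same direction; the current graph at that moment is the outcome. *Jaeger trees.* The tour of a spanning tree $T$ of $G$ is the following sequence of node-edge pairs: it starts with $(b_0,b_0b_1)$; the pair $(x,xy)$ is followed by $(x,xy^+_G)$ if $xy\notin T$ and by $(y,yx^+_G)$ if $xy\in T$; the tour stops right before $(b_0,b_0b_1)$ would recur. For $C\in\{V,E\}$, $T$ is a $C$-cut Jaeger tree if for each edge $xy$ of $G$ not in $T$, with $x\in C$, the pair $(x,xy)$ precedes $(y,xy)$ in the tour of $T$. **Theorem.** Each of the four Bernardi processes stops on every hypertree on the relevant class, and so has a well-defined outcome. The set of outcomes of the (ht:$E$, cut:$V$) process over all hypertrees on $E$, and the set of outcomes of the (ht:$V$, cut:$V$) process over all hypertrees on $V$, are both equal to the set of $V$-cut Jaeger trees. In the same way, the set of outcomes of the (ht:$E$, cut:$E$) process and the set of outcomes of the (ht:$V$, cut:$E$) process are both equal to the set of $E$-cut Jaeger trees. -/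

import Mathlib

namespace RibbonBernardi

variable {N : Type*}

/-- A ribbon structure on a simple graph `G`: for each node `x`, a cyclic permutation of the edges
incident to `x`. An edge `xy` at `x` is recorded by its other endpoint `y`, so that the edge
following `xy` at `x` is the edge from `x` to `rot x y`. (The values of `rot x` away from the
neighbours of `x` play no role.) -/
structure RibbonStructure (G : SimpleGraph N) where
  rot : N → Equiv.Perm N
  isCycleOn_rot : ∀ x, (rot x).IsCycleOn (G.neighborSet x)

/-- `R.next H x y` is the other endpoint of `xy⁺` in the subgraph `H`, i.e. of the edge that
follows `xy` at `x` in the cyclic order inherited by `H`: the first edge of `H` met when rotating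
around `x`, starting right after `xy`. (It is `y` itself if `xy` is the only edge of `H` at `x`.) -/
noncomputable def RibbonStructure.next {G : SimpleGraph N} (R : RibbonStructure G)
    (H : SimpleGraph N) (x y : N) : N :=
  (R.rot x ^ sInf {k : ℕ | 0 < k ∧ H.Adj x ((R.rot x ^ k) y)}) y

/-- `T` is a spanning tree of `G`. -/
def IsSpanningTree (G T : SimpleGraph N) : Prop := T ≤ G ∧ T.IsTree

/-- `f` is a hypertree of the graph `G` on the class `A`: some spanning tree of `G` has degree
`f a + 1` at each node `a` of `A`. -/
def IsHypertree (G : SimpleGraph N) (A : Set N) (f : A → ℕ) : Prop :=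
  ∃ T : SimpleGraph N, IsSpanningTree G T ∧ ∀ a : A, (T.neighborSet a).ncard = f a + 1

/-! ### The tour of a spanning tree and Jaeger trees -/

section Tour

variable {G : SimpleGraph N} (R : RibbonStructure G)

open Classical in
/-- One step of the tour of `T`. The pair `(x, y)` stands for the node-edge pair `(x, xy)`.
An edge in `T` is traversed, an edge not in `T` is skipped. -/
noncomputable def tourStep (T : SimpleGraph N) (p : N × N) : N × N :=
  if T.Adj p.1 p.2 then (p.2, R.rot p.2 p.1) else (p.1, R.rot p.1 p.2)

/-- The tour of `T` from the base node `b₀` and base edge `b₀b₁` lasts for `i` steps at least, and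
`p` is its pair number `i` (counting from `0`). The tour stops right before `(b₀, b₀b₁)` would
become current again. -/
def TourAt (b₀ b₁ : N) (T : SimpleGraph N) (i : ℕ) (p : N × N) : Prop :=
  (tourStep R T)^[i] (b₀, b₁) = p ∧
    ∀ j, 0 < j → j ≤ i → (tourStep R T)^[j] (b₀, b₁) ≠ (b₀, b₁)

/-- `p <_T q`: the pair `p` precedes the pair `q` in the tour of `T`. -/
def TourLT (b₀ b₁ : N) (T : SimpleGraph N) (p q : N × N) : Prop :=
  ∃ i j, i < j ∧ TourAt R b₀ b₁ T i p ∧ TourAt R b₀ b₁ T j q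

/-- `C`-cut Jaeger trees: spanning trees `T` such that in the tour of `T`, each edge of `G` that is
not in `T` is cut at (i.e. is first skipped at) its endpoint in the class `C`. -/
def jaegerTrees (b₀ b₁ : N) (C : Set N) : Set (SimpleGraph N) :=
  {T | IsSpanningTree G T ∧
    ∀ x y, x ∈ C → G.Adj x y → ¬ T.Adj x y → TourLT R b₀ b₁ T (x, y) (y, x)}

end Tour

/-! ### The Bernardi processes -/

/-- A state of the process: the current graph, the current edge `cur = (c, d)` with `c` its endpoint
in the class at which edges may be cut, and the pairs `(x, y)` such that the edge `xy` has been
traversed from the direction of `x`. -/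
structure State (N : Type*) where
  graph : SimpleGraph N
  cur : N × N
  traversed : Set (N × N)

section Run

variable {G : SimpleGraph N} (R : RibbonStructure G)

open Classical in
/-- The initial state of the process that cuts at the class `C`. -/
noncomputable def initial (b₀ b₁ : N) (C : Set N) : State N :=
  if b₀ ∈ C then ⟨G, (b₀, b₁), ∅⟩ else ⟨G, (b₁, R.rot b₁ b₀), {(b₀, b₁)}⟩

/-- The current graph without the current edge. -/
def State.deleted (s : State N) : SimpleGraph N := s.graph.deleteEdges {s(s.cur.1, s.cur.2)}

/-- The current edge is `cd`; `State.forced` is the `w` such that `dw` is the edge following `dc` at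
`d` in the current graph. If `cd` is kept, then `cd` is traversed from `c` and `dw` from `d`. -/
noncomputable def State.forced (s : State N) : N := R.next s.graph s.cur.2 s.cur.1

/-- Keeping the current edge, hence traversing it and the forced edge, would not traverse any edge
from the same direction for the second time. -/
def State.MayTraverse (s : State N) : Prop :=
  s.cur ∉ s.traversed ∧ (s.cur.2, s.forced R) ∉ s.traversed

/-- One step of the process on the vector `f` on the class `A`. -/
inductive Step (A : Set N) (f : A → ℕ) : State N → State N → Prop
  | remove (s : State N) (h : IsHypertree s.deleted A f) :
      Step A f s ⟨s.deleted, (s.cur.1, R.next s.graph s.cur.1 s.cur.2), s.traversed⟩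
  | traverse (s : State N) (h : ¬ IsHypertree s.deleted A f) (h' : s.MayTraverse R) :
      Step A f s ⟨s.graph, (s.forced R, R.next s.graph (s.forced R) s.cur.2),
        s.traversed ∪ {s.cur, (s.cur.2, s.forced R)}⟩

/-- The process stops in the state `s`: the current edge would have to be kept, and an edge would be
traversed from the same direction for the second time. -/
def Stops (A : Set N) (f : A → ℕ) (s : State N) : Prop :=
  ¬ IsHypertree s.deleted A f ∧ ¬ s.MayTraverse R

/-- The (ht: `A`, cut: `C`) Bernardi process, run on `f`, stops, and `T` is the current graph at its
end. -/
def IsOutcome (b₀ b₁ : N) (A C : Set N) (f : A → ℕ) (T : SimpleGraph N) : Prop :=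
  ∃ s : State N, Relation.ReflTransGen (Step R A f) (initial R b₀ b₁ C) s ∧
    Stops R A f s ∧ s.graph = T

/-- The set of the outcomes of the (ht: `A`, cut: `C`) Bernardi process on all hypertrees on `A`. -/
def bernardiOutcomes (b₀ b₁ : N) (A C : Set N) : Set (SimpleGraph N) :=
  {T | ∃ f : A → ℕ, IsHypertree G A f ∧ IsOutcome R b₀ b₁ A C f T}

end Run

end RibbonBernardi

namespace RibbonBernardi

variable {N : Type*}

/-! ### The tour of a spanning tree visits every node-edge pair -/

/-! Fix the cut class `C` and a hypertree `f` on `A`, where `A` is `C` or its complement. Two facts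
suffice: some `C`-cut Jaeger tree realizes `f` (`exists_jaegerTree`), and the process on `f` ends in
any such tree (`isOutcome_of_mem_jaegerTrees`). The process is deterministic, so outcomes are
unique; conversely, a Jaeger tree is the outcome for its own degree vector.

Existence: among the spanning trees realizing `f`, take one whose tour is lexicographically largest,
where at each pair cutting at `C` or traversing from outside `C` is preferred. If a non-tree edge
were first skipped outside `C`, it could be exchanged for a tree edge with the same endpoint in `A`.
This preserves `f` and enlarges the key (`cutKey_lt_exchange`).

Following: along the tour of a Jaeger tree `T`, the current graph consists of `T` and the edges not
yet skipped at `C`. A non-tree edge met at `C` is removable because `T` survives. A tree edge `cd`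
is not: by the Jaeger property, apart from `cd`, no remaining edge joins a node of `C` on the side
of `c` to the side of `d`. An edge count on one side then excludes another tree with the same
degrees (`not_isHypertree_deleteEdges`).

Both parts rest on two properties of the tour: it reaches every node-edge pair
(`sameCycle_tourPerm`), and it visits the far side of a tree edge exactly between the two traversals
of that edge (`reachable_tourPair_iff`). -/

theorem sameCycle_mul_swap {α : Type*} [Finite α] [DecidableEq α] {τ : Equiv.Perm α} {a b : α}
    (hab : ¬ τ.SameCycle a b) : (τ * Equiv.swap a b).SameCycle a b := by
  have hσa : (τ * Equiv.swap a b) a = τ b := by simp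
  have hex : ∃ n, (τ ^ n) (τ b) = b :=
    (Equiv.Perm.sameCycle_apply_left.2 (Equiv.Perm.SameCycle.refl τ b)).exists_nat_pow_eq
  classical
  -- From `τ b` the new permutation follows the old cycle of `b` until it first returns to `b`; it
  -- cannot meet `a`, which lies on another cycle.
  have key : ∀ k ≤ Nat.find hex, ((τ * Equiv.swap a b) ^ k) (τ b) = (τ ^ k) (τ b) := by
    intro k
    induction k with
    | zero => simp
    | succ k ih =>
      intro hk
      rw [pow_succ', pow_succ', Equiv.Perm.mul_apply, ih (by omega), Equiv.Perm.mul_apply,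
        Equiv.Perm.mul_apply]
      congr 1
      refine Equiv.swap_apply_of_ne_of_ne (fun h => hab ?_) (Nat.find_min hex (by omega))
      rw [← h, Equiv.Perm.sameCycle_pow_left, Equiv.Perm.sameCycle_apply_left]
  have h := (key _ le_rfl).trans (Nat.find_spec hex)
  rw [← Equiv.Perm.sameCycle_apply_left, hσa]
  exact ⟨(Nat.find hex : ℕ), by rw [zpow_natCast]; exact h⟩

theorem SameCycle.mul_swap {α : Type*} [Finite α] [DecidableEq α] {τ : Equiv.Perm α} {a b x y : α}
    (hab : ¬ τ.SameCycle a b) (hxy : τ.SameCycle x y) :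
    (τ * Equiv.swap a b).SameCycle x y := by
  have hm := sameCycle_mul_swap hab
  have step : ∀ z, (τ * Equiv.swap a b).SameCycle z (τ z) := by
    intro z
    by_cases hza : z = a
    · have : τ z = (τ * Equiv.swap a b) b := by simp [hza]
      rw [this, Equiv.Perm.sameCycle_apply_right, hza]
      exact hm
    by_cases hzb : z = b
    · have : τ z = (τ * Equiv.swap a b) a := by simp [hzb]
      rw [this, Equiv.Perm.sameCycle_apply_right, hzb]
      exact hm.symm
    · have : τ z = (τ * Equiv.swap a b) z := by simp [Equiv.swap_apply_of_ne_of_ne hza hzb]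
      rw [this, Equiv.Perm.sameCycle_apply_right]
  obtain ⟨n, rfl⟩ := hxy.exists_nat_pow_eq
  clear hxy
  induction n with
  | zero => exact Equiv.Perm.SameCycle.refl _ _
  | succ n ih =>
    rw [pow_succ', Equiv.Perm.mul_apply]
    exact ih.trans (step _)

theorem adj_rot {G : SimpleGraph N} (R : RibbonStructure G) {x y : N} :
    G.Adj x (R.rot x y) ↔ G.Adj x y :=
  (R.isCycleOn_rot x).apply_mem_iff

open Classical in
/-- Turning the pairs `(x, xy)` with `xy` in `F` around. -/
noncomputable def flipPerm (F : SimpleGraph N) : Equiv.Perm (N × N) :=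
  Function.Involutive.toPerm (fun p => if F.Adj p.1 p.2 then p.swap else p) (by
    intro p
    by_cases h : F.Adj p.1 p.2
    · simp [h, h.symm]
    · simp [h])

open Classical in
theorem flipPerm_apply (F : SimpleGraph N) (p : N × N) :
    flipPerm F p = if F.Adj p.1 p.2 then p.swap else p := rfl

/-- The step of the tour as a permutation. -/
noncomputable def tourPerm {G : SimpleGraph N} (R : RibbonStructure G) (F : SimpleGraph N) :
    Equiv.Perm (N × N) :=
  Equiv.prodShear (Equiv.refl N) R.rot * flipPerm F

theorem tourPerm_apply {G : SimpleGraph N} (R : RibbonStructure G) (F : SimpleGraph N)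
    (p : N × N) : tourPerm R F p = tourStep R F p := by
  rw [tourPerm, Equiv.Perm.mul_apply, flipPerm_apply, tourStep]
  split_ifs <;> simp

theorem tourPerm_pow {G : SimpleGraph N} (R : RibbonStructure G) (F : SimpleGraph N) (n : ℕ)
    (p : N × N) : (tourPerm R F ^ n) p = (tourStep R F)^[n] p := by
  rw [← Equiv.Perm.iterate_eq_pow]
  congr 1
  funext q
  exact tourPerm_apply R F q

theorem tourStep_of_adj {G : SimpleGraph N} (R : RibbonStructure G) {T : SimpleGraph N}
    {p : N × N} (h : T.Adj p.1 p.2) : tourStep R T p = (p.2, R.rot p.2 p.1) := by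
  simp [tourStep, h]

theorem tourStep_of_not_adj {G : SimpleGraph N} (R : RibbonStructure G) {T : SimpleGraph N}
    {p : N × N} (h : ¬ T.Adj p.1 p.2) : tourStep R T p = (p.1, R.rot p.1 p.2) := by
  simp [tourStep, h]

theorem adj_tourStep {G : SimpleGraph N} (R : RibbonStructure G) (T : SimpleGraph N) {p : N × N}
    (h : G.Adj p.1 p.2) : G.Adj (tourStep R T p).1 (tourStep R T p).2 := by
  rw [tourStep]
  split_ifs
  · exact (adj_rot R).2 h.symm
  · exact (adj_rot R).2 h

theorem reachable_tourStep {G : SimpleGraph N} (R : RibbonStructure G) (T : SimpleGraph N)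
    (p : N × N) : T.Reachable p.1 (tourStep R T p).1 := by
  rw [tourStep]
  split_ifs with h
  · exact h.reachable
  · exact SimpleGraph.Reachable.refl _

theorem reachable_of_sameCycle [Finite N] {G : SimpleGraph N} (R : RibbonStructure G)
    (F : SimpleGraph N) {p q : N × N} (h : (tourPerm R F).SameCycle p q) :
    F.Reachable p.1 q.1 := by
  obtain ⟨n, rfl⟩ := h.exists_nat_pow_eq
  clear h
  induction n with
  | zero => simp
  | succ n ih =>
    rw [pow_succ', Equiv.Perm.mul_apply, tourPerm_apply]
    exact ih.trans (reachable_tourStep R F _)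

theorem deleteEdges_pair_adj {T : SimpleGraph N} {u v a b : N} :
    (T.deleteEdges {s(u, v)}).Adj a b ↔
      T.Adj a b ∧ ¬ ((a = u ∧ b = v) ∨ (a = v ∧ b = u)) := by
  simp [SimpleGraph.deleteEdges_adj]

theorem reachable_deleteEdges_or {T : SimpleGraph N} (u v : N) {a b : N} (h : T.Reachable a b) :
    (T.deleteEdges {s(u, v)}).Reachable a b ∨
    ((T.deleteEdges {s(u, v)}).Reachable a u ∨ (T.deleteEdges {s(u, v)}).Reachable a v) ∧
    ((T.deleteEdges {s(u, v)}).Reachable b u ∨ (T.deleteEdges {s(u, v)}).Reachable b v) := by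
  obtain ⟨w⟩ := h
  induction w with
  | nil => exact Or.inl (SimpleGraph.Reachable.refl _)
  | @cons a c b hac w ih =>
    by_cases he : (T.deleteEdges {s(u, v)}).Adj a c
    · have := he.reachable
      rcases ih with ih | ⟨h1 | h1, h2⟩
      · exact Or.inl (this.trans ih)
      · exact Or.inr ⟨Or.inl (this.trans h1), h2⟩
      · exact Or.inr ⟨Or.inr (this.trans h1), h2⟩
    · rw [deleteEdges_pair_adj] at he
      have he : (a = u ∧ c = v) ∨ (a = v ∧ c = u) := by tauto
      have ha : (T.deleteEdges {s(u, v)}).Reachable a u ∨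
          (T.deleteEdges {s(u, v)}).Reachable a v := by
        rcases he with ⟨rfl, -⟩ | ⟨rfl, -⟩
        · exact Or.inl (SimpleGraph.Reachable.refl _)
        · exact Or.inr (SimpleGraph.Reachable.refl _)
      refine Or.inr ⟨ha, ?_⟩
      rcases ih with ih | ⟨-, h2⟩
      · rcases he with ⟨-, rfl⟩ | ⟨-, rfl⟩
        · exact Or.inr ih.symm
        · exact Or.inl ih.symm
      · exact h2

theorem tourPerm_eq_mul_swap [DecidableEq N] {G : SimpleGraph N} (R : RibbonStructure G)
    {F : SimpleGraph N} {u v : N} (huv : F.Adj u v) :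
    tourPerm R F = tourPerm R (F.deleteEdges {s(u, v)}) * Equiv.swap (u, v) (v, u) := by
  rw [tourPerm, tourPerm, mul_assoc]
  congr 1
  ext1 p
  rw [Equiv.Perm.mul_apply, flipPerm_apply, flipPerm_apply]
  by_cases h1 : p = (u, v)
  · subst h1
    simp [huv]
  by_cases h2 : p = (v, u)
  · subst h2
    simp [huv.symm]
  rw [Equiv.swap_apply_of_ne_of_ne h1 h2, deleteEdges_pair_adj]
  have : ¬ ((p.1 = u ∧ p.2 = v) ∨ (p.1 = v ∧ p.2 = u)) := by
    rintro (⟨rfl, rfl⟩ | ⟨rfl, rfl⟩)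
    · exact h1 rfl
    · exact h2 rfl
  by_cases h : F.Adj p.1 p.2 <;> simp [this, h]

/-- Adding a forest edge `uv` multiplies the tour permutation by the transposition of `(u, v)` and
`(v, u)`. Cycles stay inside components and `uv` is a bridge, so these pairs lie on different cycles
beforehand, and the transposition merges the two. Forests rather than trees make the induction on
edges possible. -/
theorem sameCycle_tourPerm [Finite N] {G : SimpleGraph N} (R : RibbonStructure G)
    (F : SimpleGraph N) (hFG : F ≤ G) (hF : F.IsAcyclic) {p q : N × N} (hp : G.Adj p.1 p.2)
    (hq : G.Adj q.1 q.2) (h : F.Reachable p.1 q.1) : (tourPerm R F).SameCycle p q := by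
  classical
  induction F using WellFoundedLT.induction generalizing p q with
  | ind F ih =>
  by_cases hE : ∃ u v, F.Adj u v
  · obtain ⟨u, v, huv⟩ := hE
    have hlt : F.deleteEdges {s(u, v)} < F :=
      lt_of_le_of_ne (SimpleGraph.deleteEdges_le _) fun h => by
        have := huv
        rw [← h, deleteEdges_pair_adj] at this
        simp at this
    have hac := hF.anti hlt.le
    have ih' := fun {p q : N × N} (hp : G.Adj p.1 p.2) (hq : G.Adj q.1 q.2) hr =>
      ih _ hlt (hlt.le.trans hFG) hac (p := p) (q := q) hp hq hr
    have hbr : ¬ (F.deleteEdges {s(u, v)}).Reachable u v :=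
      SimpleGraph.isBridge_iff.1 (SimpleGraph.isAcyclic_iff_forall_adj_isBridge.1 hF huv)
    have hns : ¬ (tourPerm R (F.deleteEdges {s(u, v)})).SameCycle (u, v) (v, u) :=
      fun h => hbr (reachable_of_sameCycle R _ h)
    have huv' : (tourPerm R F).SameCycle (u, v) (v, u) := by
      rw [tourPerm_eq_mul_swap R huv]
      exact sameCycle_mul_swap hns
    have lift : ∀ {p q : N × N}, G.Adj p.1 p.2 → G.Adj q.1 q.2 →
        (F.deleteEdges {s(u, v)}).Reachable p.1 q.1 → (tourPerm R F).SameCycle p q := by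
      intro p q hp hq hr
      rw [tourPerm_eq_mul_swap R huv]
      exact SameCycle.mul_swap hns (ih' hp hq hr)
    have hGuv := hFG huv
    have near : ∀ {p : N × N}, G.Adj p.1 p.2 → (F.deleteEdges {s(u, v)}).Reachable p.1 u ∨
        (F.deleteEdges {s(u, v)}).Reachable p.1 v → (tourPerm R F).SameCycle p (u, v) := by
      rintro p hp (h | h)
      · exact lift hp hGuv h
      · exact (lift (q := (v, u)) hp hGuv.symm h).trans huv'.symm
    rcases reachable_deleteEdges_or u v h with h | ⟨h1, h2⟩
    · exact lift hp hq h
    · exact (near hp h1).trans (near hq h2).symm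
  -- Without edges the tour only rotates about one node, and the ribbon structure is cyclic there.
  · push Not at hE
    have hpq : p.1 = q.1 := by
      obtain ⟨w⟩ := h
      generalize p.1 = a at w
      generalize q.1 = b at w
      cases w with
      | nil => rfl
      | cons h => exact absurd h (hE _ _)
    obtain ⟨x, y⟩ := p
    obtain ⟨x', z⟩ := q
    obtain rfl : x = x' := hpq
    obtain ⟨n, hn⟩ := ((R.isCycleOn_rot x).2 hp hq).exists_nat_pow_eq
    refine ⟨(n : ℕ), ?_⟩
    rw [zpow_natCast]
    change (R.rot x ^ n) y = z at hn
    rw [← hn]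
    clear hn
    induction n with
    | zero => simp
    | succ n ih =>
      rw [pow_succ', Equiv.Perm.mul_apply, ih, tourPerm_apply, tourStep_of_not_adj R (hE _ _),
        pow_succ', Equiv.Perm.mul_apply]

/-! ### Positions in the tour -/

section TourIndex

variable {G : SimpleGraph N} (R : RibbonStructure G) (b₀ b₁ : N) (T : SimpleGraph N)

/-- The node-edge pair number `i` of the tour of `T`, continued periodically. -/
noncomputable def tourPair (i : ℕ) : N × N := (tourStep R T)^[i] (b₀, b₁)

/-- The length of the tour of `T`. -/
noncomputable def tourLength : ℕ := Function.minimalPeriod (tourStep R T) (b₀, b₁)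

variable {R b₀ b₁ T}

theorem tourPair_zero : tourPair R b₀ b₁ T 0 = (b₀, b₁) := rfl

theorem tourPair_succ (i : ℕ) :
    tourPair R b₀ b₁ T (i + 1) = tourStep R T (tourPair R b₀ b₁ T i) :=
  Function.iterate_succ_apply' _ _ _

theorem tourPair_tourLength : tourPair R b₀ b₁ T (tourLength R b₀ b₁ T) = (b₀, b₁) :=
  Function.iterate_minimalPeriod

theorem tourLength_pos [Finite N] : 0 < tourLength R b₀ b₁ T := by
  refine Function.IsPeriodicPt.minimalPeriod_pos (orderOf_pos (tourPerm R T)) ?_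
  rw [Function.IsPeriodicPt, Function.IsFixedPt, ← tourPerm_pow, pow_orderOf_eq_one]
  rfl

theorem tourPair_injOn {i j : ℕ} (hi : i < tourLength R b₀ b₁ T) (hj : j < tourLength R b₀ b₁ T)
    (h : tourPair R b₀ b₁ T i = tourPair R b₀ b₁ T j) : i = j :=
  (Function.iterate_eq_iterate_iff_of_lt_minimalPeriod hi hj).1 h

theorem tourAt_iff [Finite N] {i : ℕ} {q : N × N} :
    TourAt R b₀ b₁ T i q ↔ i < tourLength R b₀ b₁ T ∧ tourPair R b₀ b₁ T i = q := by
  constructor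
  · rintro ⟨h1, h2⟩
    refine ⟨?_, h1⟩
    by_contra h
    exact h2 _ tourLength_pos (not_lt.1 h) tourPair_tourLength
  · rintro ⟨h1, h2⟩
    refine ⟨h2, fun j hj hji h => ?_⟩
    exact Function.not_isPeriodicPt_of_pos_of_lt_minimalPeriod hj.ne' (hji.trans_lt h1) h

theorem adj_tourPair (hb : G.Adj b₀ b₁) (i : ℕ) :
    G.Adj (tourPair R b₀ b₁ T i).1 (tourPair R b₀ b₁ T i).2 := by
  induction i with
  | zero => exact hb
  | succ i ih => rw [tourPair_succ]; exact adj_tourStep R T ih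

theorem exists_tourPair_eq [Finite N] (hT : IsSpanningTree G T) (hb : G.Adj b₀ b₁) {x y : N}
    (hxy : G.Adj x y) : ∃ i < tourLength R b₀ b₁ T, tourPair R b₀ b₁ T i = (x, y) := by
  obtain ⟨n, hn⟩ := (sameCycle_tourPerm R T hT.1 hT.2.isAcyclic (p := (b₀, b₁)) (q := (x, y))
    hb hxy (hT.2.connected.preconnected _ _)).exists_nat_pow_eq
  refine ⟨n % tourLength R b₀ b₁ T, Nat.mod_lt _ tourLength_pos, ?_⟩
  rw [tourPair, tourLength, Function.iterate_mod_minimalPeriod_eq, ← tourPerm_pow, hn]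

theorem reachable_tourPair {u v : N} {i k : ℕ} (hik : i ≤ k)
    (h : ∀ j, i ≤ j → j < k → tourPair R b₀ b₁ T j ≠ (u, v) ∧ tourPair R b₀ b₁ T j ≠ (v, u)) :
    (T.deleteEdges {s(u, v)}).Reachable (tourPair R b₀ b₁ T i).1 (tourPair R b₀ b₁ T k).1 := by
  induction k, hik using Nat.le_induction with
  | base => exact SimpleGraph.Reachable.refl _
  | succ k hk ih =>
    refine (ih fun j hj hjk => h j hj (by omega)).trans ?_
    obtain ⟨h1, h2⟩ := h k hk (by omega)
    rw [tourPair_succ, tourStep]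
    split_ifs with hadj
    · refine SimpleGraph.Adj.reachable (deleteEdges_pair_adj.2 ⟨hadj, ?_⟩)
      rintro (⟨h3, h4⟩ | ⟨h3, h4⟩)
      · exact h1 (Prod.ext h3 h4)
      · exact h2 (Prod.ext h3 h4)
    · exact SimpleGraph.Reachable.refl _

theorem not_reachable_deleteEdges (hT : T.IsAcyclic) {u v : N} (huv : T.Adj u v) :
    ¬ (T.deleteEdges {s(u, v)}).Reachable u v :=
  SimpleGraph.isBridge_iff.1 (SimpleGraph.isAcyclic_iff_forall_adj_isBridge.1 hT huv)

/-- The tour visits the component of `v` in `T - uv` exactly between the two traversals of `uv`. -/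
theorem reachable_tourPair_iff (hT : T.IsAcyclic) {u v : N} (huv : T.Adj u v) {α β i : ℕ}
    (hα : tourPair R b₀ b₁ T α = (u, v)) (hβ : tourPair R b₀ b₁ T β = (v, u)) (hαβ : α < β)
    (hβL : β < tourLength R b₀ b₁ T) (hi : i < tourLength R b₀ b₁ T) :
    (T.deleteEdges {s(u, v)}).Reachable v (tourPair R b₀ b₁ T i).1 ↔ α < i ∧ i ≤ β := by
  have hbr := not_reachable_deleteEdges hT huv
  have hne : ∀ j, j < tourLength R b₀ b₁ T → j ≠ α → j ≠ β →
      tourPair R b₀ b₁ T j ≠ (u, v) ∧ tourPair R b₀ b₁ T j ≠ (v, u) := by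
    intro j hj h1 h2
    rw [← hα, ← hβ]
    exact ⟨fun h => h1 (tourPair_injOn hj (hαβ.trans hβL) h),
      fun h => h2 (tourPair_injOn hj hβL h)⟩
  constructor
  · intro h
    by_contra hcon
    rcases le_or_gt i α with hiα | hiα
    · have := reachable_tourPair hiα (u := u) (v := v) fun j h1 h2 => hne j (by omega) (by omega)
        (by omega)
      rw [hα] at this
      exact hbr (h.trans this).symm
    · have := reachable_tourPair (i := β + 1) (k := i) (by omega) (u := u) (v := v)
        fun j h1 h2 => hne j (by omega) (by omega) (by omega)
      rw [tourPair_succ, hβ, tourStep_of_adj R huv.symm] at this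
      exact hbr (this.trans h.symm)
  · rintro ⟨h1, h2⟩
    have := reachable_tourPair h2 (u := u) (v := v) fun j h3 h4 => hne j (by omega) (by omega)
      (by omega)
    rw [hβ] at this
    exact this.symm

theorem tourPair_congr {T' : SimpleGraph N} {i : ℕ}
    (h : ∀ j < i, (T.Adj (tourPair R b₀ b₁ T j).1 (tourPair R b₀ b₁ T j).2 ↔
      T'.Adj (tourPair R b₀ b₁ T j).1 (tourPair R b₀ b₁ T j).2)) {j : ℕ} (hj : j ≤ i) :
    tourPair R b₀ b₁ T' j = tourPair R b₀ b₁ T j := by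
  induction j with
  | zero => rfl
  | succ j ih =>
    rw [tourPair_succ, tourPair_succ, ih (by omega)]
    have hj' := h j (by omega)
    by_cases hadj : T.Adj (tourPair R b₀ b₁ T j).1 (tourPair R b₀ b₁ T j).2
    · rw [tourStep_of_adj R hadj, tourStep_of_adj R (hj'.1 hadj)]
    · rw [tourStep_of_not_adj R hadj, tourStep_of_not_adj R (fun h => hadj (hj'.2 h))]

theorem jaeger_lt [Finite N] {C : Set N} (hT : T ∈ jaegerTrees R b₀ b₁ C) {x y : N} (hx : x ∈ C)
    (hG : G.Adj x y) (hxy : ¬ T.Adj x y) {i j : ℕ} (hi : i < tourLength R b₀ b₁ T)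
    (hj : j < tourLength R b₀ b₁ T) (hpi : tourPair R b₀ b₁ T i = (x, y))
    (hpj : tourPair R b₀ b₁ T j = (y, x)) : i < j := by
  obtain ⟨i', j', hij, h1, h2⟩ := hT.2 x y hx hG hxy
  rw [tourAt_iff] at h1 h2
  rw [tourPair_injOn hi h1.1 (hpi.trans h1.2.symm), tourPair_injOn hj h2.1 (hpj.trans h2.2.symm)]
  exact hij

end TourIndex

/-! ### Every hypertree is realized by a Jaeger tree -/

section Exchange

variable {G : SimpleGraph N}

/-- For each pair of the tour, whether `T` cuts at `C` or traverses away from `C`. Among the trees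
that realize a hypertree, the one with the lexicographically largest key is the Jaeger tree. -/
noncomputable def cutKey (R : RibbonStructure G) (b₀ b₁ : N) (C : Set N) (T : SimpleGraph N) :
    Lex (ℕ → Prop) :=
  toLex fun i => ((tourPair R b₀ b₁ T i).1 ∈ C ↔
    ¬ T.Adj (tourPair R b₀ b₁ T i).1 (tourPair R b₀ b₁ T i).2)

theorem cutKey_lt {R : RibbonStructure G} {b₀ b₁ : N} {C : Set N} {T T' : SimpleGraph N} {i : ℕ}
    (h : ∀ j < i, (T.Adj (tourPair R b₀ b₁ T j).1 (tourPair R b₀ b₁ T j).2 ↔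
      T'.Adj (tourPair R b₀ b₁ T j).1 (tourPair R b₀ b₁ T j).2))
    (hT : ¬ ((tourPair R b₀ b₁ T i).1 ∈ C ↔
      ¬ T.Adj (tourPair R b₀ b₁ T i).1 (tourPair R b₀ b₁ T i).2))
    (hT' : (tourPair R b₀ b₁ T i).1 ∈ C ↔
      ¬ T'.Adj (tourPair R b₀ b₁ T i).1 (tourPair R b₀ b₁ T i).2) :
    cutKey R b₀ b₁ C T < cutKey R b₀ b₁ C T' := by
  refine ⟨i, fun j hj => ?_, ?_⟩
  · simp only [cutKey, Pi.toLex_apply, tourPair_congr h hj.le, h j hj]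
  · simp only [cutKey, Pi.toLex_apply, tourPair_congr h le_rfl, eq_iff_iff.2 (iff_of_false hT id),
      eq_iff_iff.2 (iff_of_true hT' trivial)]
    exact lt_of_le_of_ne (fun h => h.elim) (by simp)

/-- `T - uv + cd`. -/
def exchange (T : SimpleGraph N) (u v c d : N) : SimpleGraph N :=
  T.deleteEdges {s(u, v)} ⊔ SimpleGraph.edge c d

theorem exchange_adj {T : SimpleGraph N} {u v c d a b : N} (hcd : c ≠ d) :
    (exchange T u v c d).Adj a b ↔ (T.Adj a b ∧ ¬ ((a = u ∧ b = v) ∨ (a = v ∧ b = u))) ∨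
      (a = c ∧ b = d) ∨ (a = d ∧ b = c) := by
  rw [exchange, SimpleGraph.sup_adj, deleteEdges_pair_adj, SimpleGraph.edge_adj]
  constructor
  · tauto
  · rintro (h | h)
    · exact Or.inl h
    · refine Or.inr ⟨by tauto, ?_⟩
      rintro rfl
      rcases h with ⟨rfl, rfl⟩ | ⟨rfl, rfl⟩ <;> exact hcd rfl

theorem isSpanningTree_exchange {T : SimpleGraph N} (hT : IsSpanningTree G T) {u v c d : N}
    (huv : T.Adj u v) (hcd : G.Adj c d) (hvc : (T.deleteEdges {s(u, v)}).Reachable v c)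
    (hud : (T.deleteEdges {s(u, v)}).Reachable u d) : IsSpanningTree G (exchange T u v c d) := by
  have hbr := not_reachable_deleteEdges hT.2.isAcyclic huv
  have hle : T.deleteEdges {s(u, v)} ≤ exchange T u v c d := le_sup_left
  have hncd : ¬ (T.deleteEdges {s(u, v)}).Reachable c d := fun h =>
    hbr (hud.trans (h.symm.trans hvc.symm))
  have : Nonempty N := ⟨u⟩
  refine ⟨fun a b h => ?_, ⟨⟨fun a b => ?_⟩, ?_⟩⟩
  · rw [exchange_adj hcd.ne] at h
    rcases h with ⟨h, -⟩ | ⟨rfl, rfl⟩ | ⟨rfl, rfl⟩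
    · exact hT.1 h
    · exact hcd
    · exact hcd.symm
  · have hcd' : (exchange T u v c d).Adj c d := (exchange_adj hcd.ne).2 (by simp)
    have huv' : (exchange T u v c d).Reachable u v :=
      (hud.mono hle).trans (hcd'.symm.reachable.trans (hvc.symm.mono hle))
    have near : ∀ a, (T.deleteEdges {s(u, v)}).Reachable a u ∨
        (T.deleteEdges {s(u, v)}).Reachable a v → (exchange T u v c d).Reachable a u := by
      rintro a (h | h)
      · exact h.mono hle
      · exact (h.mono hle).trans huv'.symm
    rcases reachable_deleteEdges_or u v (hT.2.connected.preconnected a b) with h | ⟨h1, h2⟩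
    · exact h.mono hle
    · exact (near a h1).trans (near b h2).symm
  · exact SimpleGraph.IsAcyclic.sup_edge_of_not_reachable hncd
      (hT.2.isAcyclic.anti (SimpleGraph.deleteEdges_le _))

/-- The tours of `T` and of the exchanged tree first differ at the earliest visit to one of the two
exchanged edges. This is either `(d, c)`, where a skip outside `C` becomes a traversal, or `(v, u)`,
where a traversal from `C` becomes a skip; both changes are improvements. -/
theorem cutKey_lt_exchange [Finite N] {R : RibbonStructure G} {b₀ b₁ : N} {C : Set N}
    {T : SimpleGraph N} (hb : G.Adj b₀ b₁) (hT : IsSpanningTree G T) {u v c d : N}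
    (huv : T.Adj u v) (hv : v ∈ C) (hc : c ∈ C) (hd : d ∉ C) (hcd : G.Adj c d)
    (hTcd : ¬ T.Adj c d) (hvc : (T.deleteEdges {s(u, v)}).Reachable v c)
    (hud : (T.deleteEdges {s(u, v)}).Reachable u d) {i j : ℕ}
    (hi : i < tourLength R b₀ b₁ T) (hj : j < tourLength R b₀ b₁ T)
    (hpi : tourPair R b₀ b₁ T i = (d, c)) (hpj : tourPair R b₀ b₁ T j = (c, d)) (hij : i < j) :
    cutKey R b₀ b₁ C T < cutKey R b₀ b₁ C (exchange T u v c d) := by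
  obtain ⟨α, hα, hpα⟩ := exists_tourPair_eq (R := R) hT hb (hT.1 huv)
  obtain ⟨β, hβ, hpβ⟩ := exists_tourPair_eq (R := R) hT hb (hT.1 huv.symm)
  have hbr := not_reachable_deleteEdges hT.2.isAcyclic huv
  have hαβ : α ≠ β := by
    rintro rfl
    rw [hpα] at hpβ
    exact huv.ne (congrArg Prod.fst hpβ)
  -- If `(u, v)` came first, the tour would be on the side of `v` from then until time `β`. As `c`
  -- lies on that side, `j ≤ β`; then `i` falls in the same interval, although `d` lies on the side
  -- of `u`.
  have hαlt : ¬ (α < i ∧ α < β) := by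
    rintro ⟨h1, h2⟩
    have hj' := (reachable_tourPair_iff hT.2.isAcyclic huv hpα hpβ h2 hβ hj).1 (by rwa [hpj])
    have hi' := (reachable_tourPair_iff hT.2.isAcyclic huv hpα hpβ h2 hβ hi).2 ⟨h1, by omega⟩
    rw [hpi] at hi'
    exact hbr (hud.trans hi'.symm)
  have hiα : i ≠ α := by
    rintro rfl
    rw [hpα] at hpi
    obtain ⟨rfl, rfl⟩ := Prod.mk.inj hpi
    exact hTcd huv.symm
  have hiβ : i ≠ β := by
    rintro rfl
    rw [hpβ] at hpi
    obtain ⟨rfl, rfl⟩ := Prod.mk.inj hpi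
    exact hTcd huv
  have agree : ∀ k, k < i → k < α → k < β →
      (T.Adj (tourPair R b₀ b₁ T k).1 (tourPair R b₀ b₁ T k).2 ↔
      (exchange T u v c d).Adj (tourPair R b₀ b₁ T k).1 (tourPair R b₀ b₁ T k).2) := by
    intro k h1 h2 h3
    have e1 : tourPair R b₀ b₁ T k ≠ (d, c) := fun h =>
      h1.ne (tourPair_injOn (by omega) hi (h.trans hpi.symm))
    have e2 : tourPair R b₀ b₁ T k ≠ (c, d) := fun h =>
      (h1.trans hij).ne (tourPair_injOn (by omega) hj (h.trans hpj.symm))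
    have e3 : tourPair R b₀ b₁ T k ≠ (u, v) := fun h =>
      h2.ne (tourPair_injOn (by omega) hα (h.trans hpα.symm))
    have e4 : tourPair R b₀ b₁ T k ≠ (v, u) := fun h =>
      h3.ne (tourPair_injOn (by omega) hβ (h.trans hpβ.symm))
    rw [exchange_adj hcd.ne]
    simp only [ne_eq, Prod.ext_iff] at e1 e2 e3 e4
    refine ⟨fun h => Or.inl ⟨h, not_or.2 ⟨e3, e4⟩⟩, ?_⟩
    rintro (h | h | h)
    · exact h.1
    · exact absurd h e2
    · exact absurd h e1
  rcases lt_or_gt_of_ne hiβ with h | h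
  · refine cutKey_lt (i := i) (fun k hk => agree k hk (by omega) (by omega)) ?_ ?_
    · rw [hpi]
      simp [hd, hTcd, SimpleGraph.adj_comm T d c]
    · rw [hpi, exchange_adj hcd.ne]
      simp [hd]
  · refine cutKey_lt (i := β) (fun k hk => agree k (by omega) (by omega) hk) ?_ ?_
    · rw [hpβ]
      simp [hv, huv.symm]
    · rw [hpβ, exchange_adj hcd.ne]
      refine iff_of_true hv ?_
      rintro (h | ⟨rfl, rfl⟩ | ⟨rfl, rfl⟩)
      · exact h.2 (Or.inr ⟨rfl, rfl⟩)
      · exact hTcd huv.symm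
      · exact hTcd huv

/-- In a tree, each pair of distinct nodes `x`, `y` determines the edge at `x` towards `y`. -/
theorem exists_adj_reachable_deleteEdges {T : SimpleGraph N} (hT : T.IsTree) {x y : N}
    (hxy : x ≠ y) : ∃ z, T.Adj x z ∧ (T.deleteEdges {s(x, z)}).Reachable z y := by
  classical
  obtain ⟨w, hw⟩ := (hT.connected.preconnected x y).exists_isPath
  cases w with
  | nil => exact absurd rfl hxy
  | @cons _ z _ h w =>
    rw [SimpleGraph.Walk.cons_isPath_iff] at hw
    refine ⟨z, h, SimpleGraph.reachable_deleteEdges_iff_exists_walk.2 ⟨w, fun he => hw.2 ?_⟩⟩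
    exact w.fst_mem_support_of_mem_edges he

theorem ncard_neighborSet_exchange [Finite N] {T : SimpleGraph N} {A : Set N} {a z o : N}
    (hz : z ∉ A) (ho : o ∉ A) (haz : T.Adj a z) (hao : ¬ T.Adj a o)
    (hne : a ≠ o) {T' : SimpleGraph N}
    (hT' : ∀ x y, T'.Adj x y ↔ (T.Adj x y ∧ ¬ ((x = a ∧ y = z) ∨ (x = z ∧ y = a))) ∨
      (x = a ∧ y = o) ∨ (x = o ∧ y = a)) {x : N} (hx : x ∈ A) :
    (T'.neighborSet x).ncard = (T.neighborSet x).ncard := by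
  have hxz : x ≠ z := fun h => hz (h ▸ hx)
  have hxo : x ≠ o := fun h => ho (h ▸ hx)
  by_cases hxa : x = a
  · subst hxa
    rw [← Set.ncard_exchange (s := T.neighborSet x) (a := o) (b := z) hao haz]
    congr 1
    ext y
    simp only [SimpleGraph.mem_neighborSet, hT', Set.mem_insert_iff, Set.mem_sdiff,
      Set.mem_singleton_iff]
    tauto
  · congr 1
    ext y
    simp only [SimpleGraph.mem_neighborSet, hT']
    tauto

theorem exists_jaegerTree [Finite N] (R : RibbonStructure G) {b₀ b₁ : N} (hb : G.Adj b₀ b₁)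
    {A C : Set N} (hC : ∀ x y, G.Adj x y → (x ∈ C ↔ y ∉ C)) (hA : A = C ∨ A = Cᶜ) {f : A → ℕ}
    (hf : IsHypertree G A f) :
    ∃ T ∈ jaegerTrees R b₀ b₁ C, ∀ a : A, (T.neighborSet a).ncard = f a + 1 := by
  obtain ⟨T, ⟨hT, hTf⟩, hmax⟩ := Set.exists_max_image
    {T : SimpleGraph N | IsSpanningTree G T ∧ ∀ a : A, (T.neighborSet a).ncard = f a + 1}
    (cutKey R b₀ b₁ C) (Set.toFinite _) hf
  refine ⟨T, ⟨hT, fun c d hc hcd hTcd => ?_⟩, hTf⟩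
  have hd : d ∉ C := (hC c d hcd).1 hc
  obtain ⟨j, hj, hpj⟩ := exists_tourPair_eq (R := R) hT hb hcd
  obtain ⟨i, hi, hpi⟩ := exists_tourPair_eq (R := R) hT hb hcd.symm
  rcases lt_trichotomy j i with h | h | h
  · exact ⟨j, i, h, tourAt_iff.2 ⟨hj, hpj⟩, tourAt_iff.2 ⟨hi, hpi⟩⟩
  · rw [h, hpi] at hpj
    exact absurd (congrArg Prod.fst hpj).symm hcd.ne
  exfalso
  -- The removed edge lies on the tree path between `c` and `d`, at whichever of the two is in `A`.
  -- The degree there is restored by `cd`, and the other endpoints involved are outside `A`.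
  rcases hA with rfl | rfl
  · obtain ⟨z, hcz, hz⟩ := exists_adj_reachable_deleteEdges hT.2 hcd.ne
    have hzA := (hC c z (hT.1 hcz)).1 hc
    rw [Sym2.eq_swap] at hz
    have h1 := isSpanningTree_exchange hT hcz.symm hcd (SimpleGraph.Reachable.refl _) hz
    refine (hmax _ ⟨h1, fun a => ?_⟩).not_gt (cutKey_lt_exchange hb hT hcz.symm hc hc hd hcd
      hTcd (SimpleGraph.Reachable.refl _) hz hi hj hpi hpj h)
    rw [← hTf a]
    refine ncard_neighborSet_exchange hzA hd hcz hTcd hcd.ne (fun x y => ?_) a.2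
    rw [exchange_adj hcd.ne]
    tauto
  · obtain ⟨z, hdz, hz⟩ := exists_adj_reachable_deleteEdges hT.2 hcd.ne.symm
    have hzC : z ∈ C := by
      by_contra hzC
      exact hd ((hC d z (hT.1 hdz)).2 hzC)
    have h1 := isSpanningTree_exchange hT hdz hcd hz (SimpleGraph.Reachable.refl _)
    refine (hmax _ ⟨h1, fun a => ?_⟩).not_gt (cutKey_lt_exchange hb hT hdz hzC hc hd hcd
      hTcd hz (SimpleGraph.Reachable.refl _) hi hj hpi hpj h)
    rw [← hTf a]
    refine ncard_neighborSet_exchange (not_not.2 hzC) (not_not.2 hc) hdz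
      (fun h => hTcd h.symm) hcd.ne.symm (fun x y => ?_) a.2
    rw [exchange_adj hcd.ne]
    tauto

end Exchange

/-! ### Edges that cannot be removed -/

theorem IsAcyclic.card_edgeSet_lt {α : Type*} [Finite α] [Nonempty α] {F : SimpleGraph α}
    (hF : F.IsAcyclic) : Nat.card F.edgeSet < Nat.card α := by
  obtain ⟨T, hFT, -, hT⟩ :=
    SimpleGraph.connected_top.exists_isTree_le_of_le_of_isAcyclic le_top hF
  have h1 := (SimpleGraph.isTree_iff_connected_and_card.1 hT).2
  have h2 : Nat.card F.edgeSet ≤ Nat.card T.edgeSet :=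
    Nat.card_mono (Set.toFinite _) (SimpleGraph.edgeSet_mono hFT)
  omega

/-- In a graph that is bipartite with class `A`, the edges inside `S` are counted by the degrees at
the elements of `A`. -/
theorem sum_ncard_neighborSet_inter [Finite N] {F : SimpleGraph N} {A : Set N}
    (hF : ∀ x y, F.Adj x y → (x ∈ A ↔ y ∉ A)) (S : Set N) :
    ∑ x ∈ (Set.toFinite (A ∩ S)).toFinset, (F.neighborSet x ∩ S).ncard =
      Nat.card (F.induce S).edgeSet := by
  classical
  have := Fintype.ofFinite N
  have hbip : (F.induce S).IsBipartiteWith ((Finset.univ.filter fun x : S => (x : N) ∈ A) : Finset S)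
      ((Finset.univ.filter fun x : S => (x : N) ∉ A) : Finset S) := by
    refine ⟨?_, fun x y h => ?_⟩
    · rw [Finset.disjoint_coe]
      exact Finset.disjoint_filter_filter_not _ _ _
    · have := hF x y h
      simp only [Finset.coe_filter, Finset.mem_univ, true_and, Set.mem_ofPred_eq]
      tauto
  have h := SimpleGraph.isBipartiteWith_sum_degrees_eq_card_edges hbip
  rw [SimpleGraph.edgeFinset_card, ← Nat.card_eq_fintype_card] at h
  rw [← h]
  symm
  refine Finset.sum_bij (fun x _ => (x : N)) ?_ ?_ ?_ ?_
  · intro x hx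
    simp only [Finset.mem_filter, Finset.mem_univ, true_and] at hx
    simp [hx]
  · intro x _ y _ hxy
    exact Subtype.ext hxy
  · intro x hx
    simp only [Set.Finite.mem_toFinset] at hx
    exact ⟨⟨x, hx.2⟩, by simp [hx.1], rfl⟩
  · intro x _
    rw [← SimpleGraph.card_neighborSet_eq_degree, ← Nat.card_eq_fintype_card,
      Nat.card_coe_set_eq, ← Set.ncard_image_of_injective _ Subtype.val_injective]
    congr 1
    ext y
    simp

/-- With equal degrees on `A`, all `T'`-edges at `A ∩ S` stay inside `S`, whereas `T` loses at least
`ao`. So `T'` has more edges inside `S` than `T`, which already has at least `|S| - 1`, and `T'`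
would contain a cycle. -/
theorem exists_ncard_neighborSet_ne [Finite N] {T T' : SimpleGraph N} {A S : Set N}
    (hT : ∀ x y, T.Adj x y → (x ∈ A ↔ y ∉ A)) (hT' : ∀ x y, T'.Adj x y → (x ∈ A ↔ y ∉ A))
    (hconn : (T.induce S).Connected) (hac : T'.IsAcyclic) {a o : N} (ha : a ∈ A) (haS : a ∈ S)
    (hoS : o ∉ S) (hao : T.Adj a o) (hcross : ∀ x y, x ∈ A → x ∈ S → T'.Adj x y → y ∈ S) :
    ¬ ∀ x ∈ A, (T'.neighborSet x).ncard = (T.neighborSet x).ncard := by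
  intro hdeg
  have : Nonempty S := ⟨⟨a, haS⟩⟩
  have h1 := hconn.card_vert_le_card_edgeSet_add_one
  have h2 := IsAcyclic.card_edgeSet_lt (hac.induce S)
  rw [← sum_ncard_neighborSet_inter hT] at h1
  rw [← sum_ncard_neighborSet_inter hT'] at h2
  have h3 : ∑ x ∈ (Set.toFinite (A ∩ S)).toFinset, (T.neighborSet x ∩ S).ncard <
      ∑ x ∈ (Set.toFinite (A ∩ S)).toFinset, (T'.neighborSet x ∩ S).ncard := by
    have hle : ∀ x ∈ (Set.toFinite (A ∩ S)).toFinset,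
        (T'.neighborSet x ∩ S).ncard = (T.neighborSet x).ncard := by
      intro x hx
      rw [Set.Finite.mem_toFinset] at hx
      have hsub : T'.neighborSet x ⊆ S := fun y hy => hcross x y hx.1 hx.2 hy
      rw [← hdeg x hx.1, Set.inter_eq_left.2 hsub]
    refine Finset.sum_lt_sum (fun x hx => ?_) ⟨a, by simp [ha, haS], ?_⟩
    · rw [hle x hx]
      exact Set.ncard_le_ncard Set.inter_subset_left
    · rw [hle a (by simp [ha, haS])]
      refine Set.ncard_lt_ncard ⟨Set.inter_subset_left, fun h => hoS ?_⟩
      exact (h hao).2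
  omega

theorem connected_induce_reachable {T F : SimpleGraph N} (hF : F ≤ T) (a : N) :
    (T.induce {x | F.Reachable a x}).Connected := by
  have h := (F.connectedComponentMk a).connected_toSimpleGraph
  have hs : (F.connectedComponentMk a).supp = {x | F.Reachable a x} := by
    ext x
    rw [SimpleGraph.ConnectedComponent.mem_supp_iff, SimpleGraph.ConnectedComponent.eq]
    exact SimpleGraph.reachable_comm
  have h' : (F.induce {x | F.Reachable a x}).Connected := hs ▸ h
  exact h'.mono fun x y hxy => hF hxy

/-- If apart from the edge `cd` of `T`, the fundamental cut of `cd` meets `H` only in edges whose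
endpoints in `C` are on the other side than `c`, then `cd` cannot be removed from `H`. -/
theorem not_isHypertree_deleteEdges [Finite N] {G T H : SimpleGraph N} {A C : Set N}
    (hC : ∀ x y, G.Adj x y → (x ∈ C ↔ y ∉ C)) (hA : A = C ∨ A = Cᶜ) (hT : IsSpanningTree G T)
    (hHG : H ≤ G) {f : A → ℕ} (hf : ∀ a : A, (T.neighborSet a).ncard = f a + 1) {c d : N}
    (hc : c ∈ C) (hcd : T.Adj c d)
    (hcross : ∀ x y, x ∈ C → H.Adj x y → ¬ (x = c ∧ y = d) →
      (T.deleteEdges {s(c, d)}).Reachable c x → ¬ (T.deleteEdges {s(c, d)}).Reachable d y) :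
    ¬ IsHypertree (H.deleteEdges {s(c, d)}) A f := by
  rintro ⟨T', hT', hf'⟩
  have hbr := not_reachable_deleteEdges hT.2.isAcyclic hcd
  have hT'H : ∀ x y, T'.Adj x y → H.Adj x y ∧ ¬ (x = c ∧ y = d) ∧ ¬ (x = d ∧ y = c) :=
    fun x y h => by
      have := hT'.1 h
      rw [deleteEdges_pair_adj] at this
      tauto
  have hor : ∀ x, (T.deleteEdges {s(c, d)}).Reachable c x ∨
      (T.deleteEdges {s(c, d)}).Reachable d x := by
    intro x
    rcases reachable_deleteEdges_or c d (hT.2.connected.preconnected c x) with h | ⟨-, h | h⟩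
    · exact Or.inl h
    · exact Or.inl h.symm
    · exact Or.inr h.symm
  have hle : T.deleteEdges {s(c, d)} ≤ T := SimpleGraph.deleteEdges_le _
  have hdeg : ∀ x ∈ A, (T'.neighborSet x).ncard = (T.neighborSet x).ncard := fun x hx =>
    (hf' ⟨x, hx⟩).trans (hf ⟨x, hx⟩).symm
  have hd := (hC c d (hT.1 hcd)).1 hc
  have hAG : ∀ x y, G.Adj x y → (x ∈ A ↔ y ∉ A) := by
    intro x y h
    have := hC x y h
    rcases hA with rfl | rfl
    · exact this
    · simp only [Set.mem_compl_iff]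
      tauto
  have hAT : ∀ x y, T.Adj x y → (x ∈ A ↔ y ∉ A) := fun x y h => hAG x y (hT.1 h)
  have hAT' : ∀ x y, T'.Adj x y → (x ∈ A ↔ y ∉ A) := fun x y h => hAG x y (hHG (hT'H x y h).1)
  -- The count is made on the side of `cd` containing its endpoint in `A`: that of `c` if `A = C`,
  -- that of `d` otherwise.
  rcases hA with rfl | rfl
  · refine exists_ncard_neighborSet_ne hAT hAT' (connected_induce_reachable hle c)
      hT'.2.isAcyclic hc (SimpleGraph.Reachable.refl _) hbr hcd (fun x y hx hxS hxy => ?_) hdeg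
    exact (hor y).resolve_right (hcross x y hx (hT'H x y hxy).1 (hT'H x y hxy).2.1 hxS)
  · refine exists_ncard_neighborSet_ne hAT hAT' (connected_induce_reachable hle d)
      hT'.2.isAcyclic hd (SimpleGraph.Reachable.refl _) (fun h => hbr h.symm) hcd.symm
      (fun x y hx hxS hxy => ?_) hdeg
    have hyx := hT'H y x hxy.symm
    have hy : y ∈ C := (hC y x (hHG hyx.1)).2 hx
    exact (hor y).resolve_left fun h => hcross y x hy hyx.1 hyx.2.1 h hxS

/-! ### The Bernardi process follows the tour of the Jaeger tree -/

theorem exists_rot_pow_eq [Finite N] {G : SimpleGraph N} (R : RibbonStructure G) {x y z : N}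
    (hy : G.Adj x y) (hz : G.Adj x z) : ∃ k, 0 < k ∧ (R.rot x ^ k) y = z := by
  obtain ⟨k, hk, -, h⟩ := ((R.isCycleOn_rot x).2 hy hz).exists_pow_eq''
  exact ⟨k, hk, h⟩

theorem next_eq {G : SimpleGraph N} (R : RibbonStructure G) {H : SimpleGraph N} {x y : N} {k : ℕ}
    (hk : 0 < k) (hadj : H.Adj x ((R.rot x ^ k) y))
    (hmin : ∀ j, 0 < j → j < k → ¬ H.Adj x ((R.rot x ^ j) y)) :
    R.next H x y = (R.rot x ^ k) y := by
  have : sInf {k : ℕ | 0 < k ∧ H.Adj x ((R.rot x ^ k) y)} = k := by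
    refine le_antisymm (Nat.sInf_le ⟨hk, hadj⟩) ?_
    by_contra hlt
    have hmem := Nat.sInf_mem (s := {k : ℕ | 0 < k ∧ H.Adj x ((R.rot x ^ k) y)}) ⟨k, hk, hadj⟩
    exact hmin _ hmem.1 (not_le.1 hlt) hmem.2
  rw [RibbonStructure.next, this]

theorem next_eq_rot {G : SimpleGraph N} (R : RibbonStructure G) {H : SimpleGraph N} {x y : N}
    (h : H.Adj x (R.rot x y)) : R.next H x y = R.rot x y := by
  have := next_eq R (k := 1) one_pos (by simpa using h) (by omega)
  simpa using this

/-- Passing from `xy` to the next edge of `T + xy`, we find an edge of `T`. -/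
theorem adj_next [Finite N] {G : SimpleGraph N} (R : RibbonStructure G) {T H : SimpleGraph N}
    {x y z : N} (hTG : T ≤ G) (hy : G.Adj x y) (hz : T.Adj x z) (hTH : T ≤ H)
    (hHT : ∀ w, H.Adj x w → T.Adj x w ∨ w = y) : T.Adj x (R.next H x y) := by
  classical
  have hex : ∃ k, 0 < k ∧ T.Adj x ((R.rot x ^ k) y) := by
    obtain ⟨k, hk, h⟩ := exists_rot_pow_eq R hy (hTG hz)
    exact ⟨k, hk, by rwa [h]⟩
  obtain ⟨hk, hT⟩ := Nat.find_spec hex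
  rw [next_eq R hk (hTH hT)]
  · exact hT
  · intro j hj hjk hH
    have hnT : ¬ T.Adj x ((R.rot x ^ j) y) := fun h => Nat.find_min hex hjk ⟨hj, h⟩
    have hyj := (hHT _ hH).resolve_left hnT
    -- The edge met at `j` is `xy` itself, so a full turn has been made and dropping it gives a
    -- smaller exponent.
    refine Nat.find_min hex (m := Nat.find hex - j) (by omega) ⟨by omega, ?_⟩
    have hsplit : (R.rot x ^ Nat.find hex) y = (R.rot x ^ (Nat.find hex - j)) y := by
      conv_lhs => rw [← Nat.sub_add_cancel hjk.le, pow_add, Equiv.Perm.mul_apply, hyj]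
    rwa [← hsplit]

section Follow

variable {G : SimpleGraph N} (R : RibbonStructure G) (b₀ b₁ : N) (C : Set N) (T : SimpleGraph N)

/-- The graph that is left of `G` when the edges outside of `T` have been removed that were skipped
at `C` in the first `i` steps of the tour. -/
def cutGraph (i : ℕ) : SimpleGraph N where
  Adj x y := T.Adj x y ∨ (G.Adj x y ∧ (∀ j < i, x ∈ C → tourPair R b₀ b₁ T j ≠ (x, y)) ∧
    ∀ j < i, y ∈ C → tourPair R b₀ b₁ T j ≠ (y, x))
  symm := ⟨fun _ _ h => h.imp (fun h => h.symm) fun h => ⟨h.1.symm, h.2.2, h.2.1⟩⟩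
  loopless := ⟨fun x h => h.elim (T.loopless.irrefl x) fun h => G.loopless.irrefl x h.1⟩

/-- The edges of `T` traversed in the first `i` steps of the tour. -/
def traversedPairs (i : ℕ) : Set (N × N) :=
  {q | T.Adj q.1 q.2 ∧ ∃ j < i, tourPair R b₀ b₁ T j = q}

/-- The state of the process that corresponds to step `i` of the tour. -/
noncomputable def tourState (i : ℕ) : State N :=
  ⟨cutGraph R b₀ b₁ C T i, tourPair R b₀ b₁ T i, traversedPairs R b₀ b₁ T i⟩

variable {R b₀ b₁ C T}

theorem cutGraph_adj {i : ℕ} {x y : N} : (cutGraph R b₀ b₁ C T i).Adj x y ↔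
    T.Adj x y ∨ (G.Adj x y ∧ (∀ j < i, x ∈ C → tourPair R b₀ b₁ T j ≠ (x, y)) ∧
    ∀ j < i, y ∈ C → tourPair R b₀ b₁ T j ≠ (y, x)) := Iff.rfl

theorem le_cutGraph (i : ℕ) : T ≤ cutGraph R b₀ b₁ C T i := fun _ _ h => Or.inl h

theorem cutGraph_le (hT : T ≤ G) (i : ℕ) : cutGraph R b₀ b₁ C T i ≤ G :=
  fun _ _ h => h.elim (fun h => hT h) fun h => h.1

theorem cutGraph_zero (hT : T ≤ G) : cutGraph R b₀ b₁ C T 0 = G :=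
  le_antisymm (cutGraph_le hT 0) fun _ _ h => Or.inr ⟨h, by simp, by simp⟩

theorem cutGraph_succ {i : ℕ} (h : T.Adj (tourPair R b₀ b₁ T i).1 (tourPair R b₀ b₁ T i).2 ∨
    (tourPair R b₀ b₁ T i).1 ∉ C) :
    cutGraph R b₀ b₁ C T (i + 1) = cutGraph R b₀ b₁ C T i := by
  have key : ∀ x y, ¬ T.Adj x y → ((∀ j < i + 1, x ∈ C → tourPair R b₀ b₁ T j ≠ (x, y)) ↔
      ∀ j < i, x ∈ C → tourPair R b₀ b₁ T j ≠ (x, y)) := by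
    intro x y hxy
    refine ⟨fun hj j hji => hj j (by omega), fun hj j hji hx he => ?_⟩
    rcases Nat.lt_succ_iff_lt_or_eq.1 hji with hji | rfl
    · exact hj j hji hx he
    · rw [he] at h
      exact h.elim hxy fun h => h hx
  ext x y
  rw [cutGraph_adj, cutGraph_adj]
  by_cases hxy : T.Adj x y
  · simp [hxy]
  · rw [key x y hxy, key y x fun h => hxy h.symm]

theorem cutGraph_eq {i k : ℕ} (hik : i ≤ k) (h : ∀ j, i ≤ j → j < k →
    T.Adj (tourPair R b₀ b₁ T j).1 (tourPair R b₀ b₁ T j).2 ∨ (tourPair R b₀ b₁ T j).1 ∉ C) :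
    cutGraph R b₀ b₁ C T k = cutGraph R b₀ b₁ C T i := by
  induction k, hik using Nat.le_induction with
  | base => rfl
  | succ k hk ih =>
    rw [cutGraph_succ (h k hk (by omega)), ih fun j h1 h2 => h j h1 (by omega)]

theorem cutGraph_deleteEdges {i : ℕ} {c d : N} (hi : tourPair R b₀ b₁ T i = (c, d)) (hc : c ∈ C)
    (hcd : ¬ T.Adj c d) :
    (cutGraph R b₀ b₁ C T i).deleteEdges {s(c, d)} = cutGraph R b₀ b₁ C T (i + 1) := by
  have key : ∀ x y, ((∀ j < i + 1, x ∈ C → tourPair R b₀ b₁ T j ≠ (x, y)) ↔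
      (∀ j < i, x ∈ C → tourPair R b₀ b₁ T j ≠ (x, y)) ∧ ¬ (x = c ∧ y = d)) := by
    intro x y
    constructor
    · refine fun h => ⟨fun j hj => h j (by omega), ?_⟩
      rintro ⟨rfl, rfl⟩
      exact h i (by omega) hc hi
    · rintro ⟨h, hne⟩ j hj hx he
      rcases Nat.lt_succ_iff_lt_or_eq.1 hj with hj | rfl
      · exact h j hj hx he
      · rw [hi] at he
        obtain ⟨rfl, rfl⟩ := Prod.mk.inj he
        exact hne ⟨rfl, rfl⟩
  ext x y
  rw [deleteEdges_pair_adj, cutGraph_adj, cutGraph_adj, key, key]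
  by_cases hxy : T.Adj x y
  · have : ¬ (x = c ∧ y = d ∨ x = d ∧ y = c) := by
      rintro (⟨rfl, rfl⟩ | ⟨rfl, rfl⟩)
      · exact hcd hxy
      · exact hcd hxy.symm
    simp [hxy, this]
  · simp only [hxy, false_or]
    tauto

theorem cutGraph_tourLength [Finite N] (hC : ∀ x y, G.Adj x y → (x ∈ C ↔ y ∉ C))
    (hT : IsSpanningTree G T) (hb : G.Adj b₀ b₁) :
    cutGraph R b₀ b₁ C T (tourLength R b₀ b₁ T) = T := by
  refine le_antisymm (fun x y h => ?_) (le_cutGraph _)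
  rcases h with h | ⟨hG, h1, h2⟩
  · exact h
  · exfalso
    by_cases hx : x ∈ C
    · obtain ⟨j, hj, he⟩ := exists_tourPair_eq (R := R) hT hb hG
      exact h1 j hj hx he
    · obtain ⟨j, hj, he⟩ := exists_tourPair_eq (R := R) hT hb hG.symm
      exact h2 j hj ((hC y x hG.symm).2 hx) he

theorem traversedPairs_succ_of_adj {i : ℕ}
    (h : T.Adj (tourPair R b₀ b₁ T i).1 (tourPair R b₀ b₁ T i).2) :
    traversedPairs R b₀ b₁ T (i + 1) =
      traversedPairs R b₀ b₁ T i ∪ {tourPair R b₀ b₁ T i} := by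
  ext q
  simp only [traversedPairs, Set.mem_ofPred_eq, Set.mem_union, Set.mem_singleton_iff]
  constructor
  · rintro ⟨hq, j, hj, rfl⟩
    rcases Nat.lt_succ_iff_lt_or_eq.1 hj with hj | rfl
    · exact Or.inl ⟨hq, j, hj, rfl⟩
    · exact Or.inr rfl
  · rintro (⟨hq, j, hj, rfl⟩ | rfl)
    · exact ⟨hq, j, by omega, rfl⟩
    · exact ⟨h, i, by omega, rfl⟩

theorem traversedPairs_eq {i k : ℕ} (hik : i ≤ k) (h : ∀ j, i ≤ j → j < k →
    ¬ T.Adj (tourPair R b₀ b₁ T j).1 (tourPair R b₀ b₁ T j).2) :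
    traversedPairs R b₀ b₁ T k = traversedPairs R b₀ b₁ T i := by
  ext q
  simp only [traversedPairs, Set.mem_ofPred_eq]
  refine and_congr_right fun hq => ⟨?_, fun ⟨j, hj, he⟩ => ⟨j, by omega, he⟩⟩
  rintro ⟨j, hj, rfl⟩
  exact ⟨j, by_contra fun hji => h j (by omega) hj hq, rfl⟩

theorem tourPair_notMem_traversedPairs {i k : ℕ} (hik : i ≤ k)
    (hk : k < tourLength R b₀ b₁ T) :
    tourPair R b₀ b₁ T k ∉ traversedPairs R b₀ b₁ T i := by
  rintro ⟨-, j, hj, he⟩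
  have := tourPair_injOn (by omega) hk he
  omega

/-- An edge that the tour has not skipped yet is still there. -/
theorem cutGraph_adj_tourPair (hC : ∀ x y, G.Adj x y → (x ∈ C ↔ y ∉ C)) (hb : G.Adj b₀ b₁)
    {i k : ℕ} (hik : i ≤ k) (hk : k < tourLength R b₀ b₁ T)
    (hkC : (tourPair R b₀ b₁ T k).1 ∈ C) :
    (cutGraph R b₀ b₁ C T i).Adj (tourPair R b₀ b₁ T k).1 (tourPair R b₀ b₁ T k).2 := by
  have hG := adj_tourPair (R := R) (T := T) hb k
  refine Or.inr ⟨hG, fun j hj _ he => ?_, fun j hj hj' _ => (hC _ _ hG).1 hkC hj'⟩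
  have := tourPair_injOn (by omega) hk he
  omega

/-- A second remaining edge `xy` across the fundamental cut, with `x ∈ C` on the side of `c`, is
visited at `x` after time `i` and at `y` later still. The times at which the tour visits either side
of `cd` do not allow this. -/
theorem not_isHypertree_cutGraph [Finite N] (hC : ∀ x y, G.Adj x y → (x ∈ C ↔ y ∉ C))
    {A : Set N} (hA : A = C ∨ A = Cᶜ) (hb : G.Adj b₀ b₁) (hT : T ∈ jaegerTrees R b₀ b₁ C)
    {f : A → ℕ} (hf : ∀ a : A, (T.neighborSet a).ncard = f a + 1) {i : ℕ}
    (hi : i < tourLength R b₀ b₁ T) {c d : N} (hp : tourPair R b₀ b₁ T i = (c, d)) (hc : c ∈ C)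
    (hcd : T.Adj c d) :
    ¬ IsHypertree ((cutGraph R b₀ b₁ C T i).deleteEdges {s(c, d)}) A f := by
  refine not_isHypertree_deleteEdges hC hA hT.1 (cutGraph_le hT.1.1 i) hf hc hcd
    fun x y hx hxy hne hxc hyd => ?_
  have hac := hT.1.2.isAcyclic
  have hbr := not_reachable_deleteEdges hac hcd
  have hd := (hC c d (hT.1.1 hcd)).1 hc
  have hnT : ¬ T.Adj x y := fun h => by
    have : (T.deleteEdges {s(c, d)}).Adj x y := by
      rw [deleteEdges_pair_adj]
      refine ⟨h, ?_⟩
      rintro (h | ⟨rfl, -⟩)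
      · exact hne h
      · exact hd hx
    exact hbr (hxc.trans (this.reachable.trans hyd.symm))
  obtain ⟨hG, huncut, -⟩ := hxy.resolve_left hnT
  obtain ⟨k, hk, hpk⟩ := exists_tourPair_eq (R := R) hT.1 hb hG
  obtain ⟨l, hl, hpl⟩ := exists_tourPair_eq (R := R) hT.1 hb hG.symm
  obtain ⟨β, hβ, hpβ⟩ := exists_tourPair_eq (R := R) hT.1 hb (hT.1.1 hcd.symm)
  have hkl := jaeger_lt hT hx hG hnT hk hl hpk hpl
  have hik : i < k := by
    have h1 : ¬ k < i := fun h => huncut k h hx hpk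
    have h2 : k ≠ i := by
      rintro rfl
      rw [hp] at hpk
      obtain ⟨rfl, rfl⟩ := Prod.mk.inj hpk
      exact hnT hcd
    omega
  have hiβ : i ≠ β := by
    rintro rfl
    rw [hp] at hpβ
    exact hcd.ne (congrArg Prod.fst hpβ)
  -- If `cd` is being traversed for the first time, the side of `d` is visited during `(i, β]`; this
  -- contains `l`, hence also `k`, so `x` would be on the side of `d`. Otherwise the side of `c` is
  -- visited during `(β, i]`, which contradicts `i < k`.
  rcases lt_or_gt_of_ne hiβ with h | h
  · have h1 := (reachable_tourPair_iff hac hcd hp hpβ h hβ hl).1 (by rwa [hpl])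
    have h2 := (reachable_tourPair_iff hac hcd hp hpβ h hβ hk).2 (by omega)
    rw [hpk] at h2
    exact hbr (hxc.trans h2.symm)
  · have h1 := (reachable_tourPair_iff hac hcd.symm hpβ hp h hi hk).1
      (by rw [hpk, Sym2.eq_swap]; exact hxc)
    omega

theorem stops_of_complete [Finite N] (hT : IsSpanningTree G T) (hb : G.Adj b₀ b₁) {A : Set N}
    (f : A → ℕ) {q : N × N} (hq : T.Adj q.1 q.2) :
    Stops R A f ⟨T, q, traversedPairs R b₀ b₁ T (tourLength R b₀ b₁ T)⟩ := by
  refine ⟨?_, fun h => h.1 ⟨hq, exists_tourPair_eq hT hb (hT.1 hq)⟩⟩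
  rintro ⟨T', hT', -⟩
  exact not_reachable_deleteEdges hT.2.isAcyclic hq
    ((hT'.2.connected.preconnected q.1 q.2).mono hT'.1)

theorem exists_adj_of_isSpanningTree (hT : IsSpanningTree G T) (hb : G.Adj b₀ b₁) (x : N) :
    ∃ z, T.Adj x z := by
  have : Nontrivial N := ⟨⟨b₀, b₁, hb.ne⟩⟩
  exact hT.2.connected.preconnected.exists_adj_of_nontrivial x

/-- Otherwise the tour would begin by skipping the base edge outside `C`. This justifies counting
the base edge as traversed at the start. -/
theorem adj_base_of_notMem [Finite N] (hC : ∀ x y, G.Adj x y → (x ∈ C ↔ y ∉ C))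
    (hb : G.Adj b₀ b₁) (hT : T ∈ jaegerTrees R b₀ b₁ C) (hb₀ : b₀ ∉ C) : T.Adj b₀ b₁ := by
  by_contra h
  obtain ⟨k, hk, hpk⟩ := exists_tourPair_eq (R := R) hT.1 hb hb.symm
  have := jaeger_lt hT ((hC b₁ b₀ hb.symm).2 hb₀) hb.symm (fun h' => h h'.symm) hk tourLength_pos
    hpk tourPair_zero
  omega

/-- One step of the process corresponds to one skip at `C`, or to a traversal from `c` to `d`, the
skips at `d`, and a traversal back to `C`. The induction is on the remaining length of the tour; the
end of the tour needs care, since the process stops only at its next attempted traversal. -/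
theorem reflTransGen_tourState [Finite N] (hC : ∀ x y, G.Adj x y → (x ∈ C ↔ y ∉ C))
    {A : Set N} (hA : A = C ∨ A = Cᶜ) (hb : G.Adj b₀ b₁) (hT : T ∈ jaegerTrees R b₀ b₁ C)
    {f : A → ℕ} (hf : ∀ a : A, (T.neighborSet a).ncard = f a + 1) {i : ℕ}
    (hi : i < tourLength R b₀ b₁ T) (hiC : (tourPair R b₀ b₁ T i).1 ∈ C) :
    ∃ s, Relation.ReflTransGen (Step R A f) (tourState R b₀ b₁ C T i) s ∧ Stops R A f s ∧
      s.graph = T := by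
  classical
  induction hn : tourLength R b₀ b₁ T - i using Nat.strong_induction_on generalizing i with
  | _ n ih =>
  subst hn
  obtain ⟨c, d, hp⟩ : ∃ c d, tourPair R b₀ b₁ T i = (c, d) := ⟨_, _, rfl⟩
  have hGcd : G.Adj c d := by
    have := adj_tourPair (R := R) (T := T) hb i
    rwa [hp] at this
  have hc : c ∈ C := by rwa [hp] at hiC
  have hd : d ∉ C := (hC c d hGcd).1 hc
  have hcur : (tourState R b₀ b₁ C T i).cur = (c, d) := hp
  have hdel : (tourState R b₀ b₁ C T i).deleted =
      (cutGraph R b₀ b₁ C T i).deleteEdges {s(c, d)} := by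
    rw [State.deleted, hcur]; rfl
  by_cases hcd : T.Adj c d
  · have hnot : ¬ IsHypertree (tourState R b₀ b₁ C T i).deleted A f := by
      rw [hdel]
      exact not_isHypertree_cutGraph hC hA hb hT hf hi hp hc hcd
    have hex : ∃ k, 0 < k ∧ T.Adj d ((R.rot d ^ k) c) := by
      obtain ⟨k, hk, h⟩ := exists_rot_pow_eq R hGcd.symm hGcd.symm
      exact ⟨k, hk, by rw [h]; exact hcd.symm⟩
    obtain ⟨k, ⟨hk, hdw⟩, hmin⟩ : ∃ k, (0 < k ∧ T.Adj d ((R.rot d ^ k) c)) ∧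
        ∀ j, 0 < j → j < k → ¬ T.Adj d ((R.rot d ^ j) c) :=
      ⟨Nat.find hex, Nat.find_spec hex, fun j h1 h2 h3 => Nat.find_min hex h2 ⟨h1, h3⟩⟩
    have hpos : ∀ j, 0 < j → j ≤ k → tourPair R b₀ b₁ T (i + j) = (d, (R.rot d ^ j) c) := by
      intro j hj hjk
      induction j, hj using Nat.le_induction with
      | base =>
        change tourPair R b₀ b₁ T (i + 1) = (d, (R.rot d ^ 1) c)
        rw [tourPair_succ, hp, tourStep_of_adj R hcd, pow_one]
      | succ j hj ih =>
        rw [← add_assoc, tourPair_succ, ih (by omega),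
          tourStep_of_not_adj R (hmin j hj (by omega)), pow_succ', Equiv.Perm.mul_apply]
    have hquiet : ∀ j, i ≤ j → j < i + k →
        T.Adj (tourPair R b₀ b₁ T j).1 (tourPair R b₀ b₁ T j).2 ∨
          (tourPair R b₀ b₁ T j).1 ∉ C := by
      intro j h1 h2
      rcases h1.eq_or_lt with rfl | h1
      · rw [hp]; exact Or.inl hcd
      · obtain ⟨l, rfl⟩ := Nat.exists_eq_add_of_lt h1
        rw [add_assoc, hpos (l + 1) (by omega) (by omega)]
        exact Or.inr hd
    -- Otherwise the tour would close up among the skips at `d`, so the base edge would be skipped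
    -- at `b₀ = d ∉ C`.
    have hikL : i + k ≤ tourLength R b₀ b₁ T := by
      by_contra hlt
      have h1 := hpos (tourLength R b₀ b₁ T - i) (by omega) (by omega)
      have h2 := hmin (tourLength R b₀ b₁ T - i) (by omega) (by omega)
      rw [Nat.add_sub_cancel' hi.le, tourPair_tourLength] at h1
      obtain ⟨h3, h4⟩ := Prod.mk.inj h1
      rw [← h4, ← h3] at h2
      exact h2 (adj_base_of_notMem hC hb hT (h3 ▸ hd))
    set w := (R.rot d ^ k) c with hw
    have hwC : w ∈ C := by
      by_contra h
      exact hd ((hC d w (hT.1.1 hdw)).2 h)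
    -- By the Jaeger property, each edge skipped at `d` on the way to `dw` was skipped earlier at
    -- its endpoint in `C`, hence is already gone from the current graph.
    have hforced : (tourState R b₀ b₁ C T i).forced R = w := by
      rw [State.forced, hcur]
      refine next_eq R hk (Or.inl hdw) fun j hj hjk hadj => ?_
      have hnT := hmin j hj hjk
      obtain ⟨hG, -, huncut⟩ := (cutGraph_adj.1 hadj).resolve_left hnT
      have hyC : (R.rot d ^ j) c ∈ C := by
        by_contra h
        exact hd ((hC _ _ hG).2 h)
      obtain ⟨m, hm, hpm⟩ := exists_tourPair_eq (R := R) hT.1 hb hG.symm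
      have hlt := jaeger_lt hT hyC hG.symm (fun h => hnT h.symm) hm (by omega) hpm
        (hpos j hj hjk.le)
      rcases lt_trichotomy m i with h | rfl | h
      · exact huncut m h hyC hpm
      · rw [hp] at hpm
        rw [← (Prod.mk.inj hpm).1] at hnT
        exact hnT hcd.symm
      · obtain ⟨l, rfl⟩ := Nat.exists_eq_add_of_lt h
        rw [add_assoc, hpos (l + 1) (by omega) (by omega)] at hpm
        exact hG.ne (congrArg Prod.fst hpm)
    rcases hikL.lt_or_eq with hlt | heq
    · have hmay : (tourState R b₀ b₁ C T i).MayTraverse R := by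
        refine ⟨tourPair_notMem_traversedPairs le_rfl hi, ?_⟩
        rw [hforced, hcur]
        change (d, w) ∉ traversedPairs R b₀ b₁ T i
        rw [hw, ← hpos k hk le_rfl]
        exact tourPair_notMem_traversedPairs (by omega) hlt
      have hstep := Step.traverse (R := R) (A := A) (f := f) _ hnot hmay
      rw [hforced, hcur] at hstep
      have hgraph : (tourState R b₀ b₁ C T i).graph = cutGraph R b₀ b₁ C T (i + k + 1) := by
        rw [cutGraph_succ, cutGraph_eq (by omega) hquiet]
        · rfl
        · rw [hpos k hk le_rfl]
          exact Or.inl hdw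
      have htrav : (tourState R b₀ b₁ C T i).traversed ∪ {(c, d), (d, w)} =
          traversedPairs R b₀ b₁ T (i + k + 1) := by
        rw [traversedPairs_succ_of_adj (by rw [hpos k hk le_rfl]; exact hdw),
          traversedPairs_eq (i := i + 1) (by omega), traversedPairs_succ_of_adj (by rwa [hp]),
          hpos k hk le_rfl, hp, Set.union_assoc]
        · rfl
        · intro j h1 h2
          obtain ⟨l, rfl⟩ := Nat.exists_eq_add_of_lt (show i < j by omega)
          rw [add_assoc, hpos (l + 1) (by omega) (by omega)]
          exact hmin _ (by omega) (by omega)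
      have hnext : tourPair R b₀ b₁ T (i + k + 1) = (w, R.rot w d) := by
        rw [tourPair_succ, hpos k hk le_rfl, tourStep_of_adj R hdw]
      rw [htrav, hgraph] at hstep
      -- When the tour is complete, the base edge may itself have been removed, so the next current
      -- edge need not be the next pair of the tour. It is in any case an edge of `T`, which
      -- suffices for stopping.
      rcases (Nat.succ_le_of_lt hlt).lt_or_eq with hlt' | heq'
      · have hrot : R.next (cutGraph R b₀ b₁ C T (i + k + 1)) w d = R.rot w d := by
          refine next_eq_rot R ?_
          have := cutGraph_adj_tourPair (C := C) hC hb le_rfl hlt' (by rw [hnext]; exact hwC)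
          rwa [hnext] at this
        rw [hrot, ← hnext] at hstep
        obtain ⟨s, hs, h1, h2⟩ := ih (tourLength R b₀ b₁ T - (i + k + 1)) (by omega) hlt'
          (by rw [hnext]; exact hwC) rfl
        exact ⟨s, Relation.ReflTransGen.head hstep hs, h1, h2⟩
      · rw [show i + k + 1 = tourLength R b₀ b₁ T from heq', cutGraph_tourLength hC hT.1 hb]
          at hstep
        refine ⟨_, Relation.ReflTransGen.single hstep, stops_of_complete hT.1 hb f ?_, rfl⟩
        exact adj_next R hT.1.1 (hT.1.1 hdw.symm) hdw.symm le_rfl fun _ h => Or.inl h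
    -- The tour closes up at `b₀ ∉ C`: the forced edge is the base edge, traversed at time `0`.
    · have hbase : (d, w) = (b₀, b₁) := by
        rw [hw, ← hpos k hk le_rfl, heq, tourPair_tourLength]
      refine ⟨_, Relation.ReflTransGen.refl, ⟨hnot, fun hmay => hmay.2 ?_⟩, ?_⟩
      · rw [hforced, hcur, hbase]
        refine ⟨?_, 0, Nat.pos_of_ne_zero ?_, tourPair_zero⟩
        · obtain ⟨h1, h2⟩ := Prod.mk.inj hbase
          rw [← h1, ← h2]
          exact hdw
        · rintro rfl
          rw [tourPair_zero] at hp
          exact hd ((Prod.mk.inj hbase).1 ▸ (Prod.mk.inj hp).1 ▸ hc)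
      · change cutGraph R b₀ b₁ C T i = T
        rw [← cutGraph_eq (by omega) hquiet, heq, cutGraph_tourLength hC hT.1 hb]
  · have hrem : IsHypertree (tourState R b₀ b₁ C T i).deleted A f := by
      rw [hdel, cutGraph_deleteEdges hp hc hcd]
      exact ⟨T, ⟨le_cutGraph _, hT.1.2⟩, hf⟩
    have hstep := Step.remove (R := R) _ hrem
    have htrav : (tourState R b₀ b₁ C T i).traversed = traversedPairs R b₀ b₁ T (i + 1) := by
      rw [traversedPairs_eq (i := i) (by omega)]
      · rfl
      · intro j h1 h2
        obtain rfl : j = i := by omega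
        rwa [hp]
    have hnext : tourPair R b₀ b₁ T (i + 1) = (c, R.rot c d) := by
      rw [tourPair_succ, hp, tourStep_of_not_adj R hcd]
    rw [hdel, cutGraph_deleteEdges hp hc hcd, hcur, htrav] at hstep
    change Step R A f _ ⟨_, (c, R.next (cutGraph R b₀ b₁ C T i) c d), _⟩ at hstep
    rcases (Nat.succ_le_of_lt hi).lt_or_eq with hlt | heq
    · have hrot : R.next (cutGraph R b₀ b₁ C T i) c d = R.rot c d := by
        refine next_eq_rot R ?_
        have := cutGraph_adj_tourPair (C := C) (i := i) hC hb (Nat.le_succ i) hlt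
          (by rw [hnext]; exact hc)
        rwa [hnext] at this
      rw [hrot, ← hnext] at hstep
      obtain ⟨s, hs, h1, h2⟩ := ih (tourLength R b₀ b₁ T - (i + 1)) (by omega) hlt
        (by rw [hnext]; exact hc) rfl
      exact ⟨s, Relation.ReflTransGen.head hstep hs, h1, h2⟩
    · have hTlast : cutGraph R b₀ b₁ C T (i + 1) = T := by
        rw [show i + 1 = tourLength R b₀ b₁ T from heq, cutGraph_tourLength hC hT.1 hb]
      have hadj : T.Adj c (R.next (cutGraph R b₀ b₁ C T i) c d) := by
        obtain ⟨z, hz⟩ := exists_adj_of_isSpanningTree hT.1 hb c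
        -- The successor is taken in the graph before the removal, where `cd` is the only edge
        -- outside `T`.
        refine adj_next R hT.1.1 hGcd hz (le_cutGraph i) fun y hy => or_iff_not_imp_right.2
          fun hyd => ?_
        rw [← hTlast, ← cutGraph_deleteEdges hp hc hcd, deleteEdges_pair_adj]
        exact ⟨hy, fun h => h.elim (fun h => hyd h.2) fun h => hGcd.ne h.1⟩
      rw [hTlast, show i + 1 = tourLength R b₀ b₁ T from heq] at hstep
      exact ⟨_, Relation.ReflTransGen.single hstep, stops_of_complete hT.1 hb f hadj, rfl⟩

theorem isOutcome_of_mem_jaegerTrees [Finite N] (hC : ∀ x y, G.Adj x y → (x ∈ C ↔ y ∉ C))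
    {A : Set N} (hA : A = C ∨ A = Cᶜ) (hb : G.Adj b₀ b₁) (hT : T ∈ jaegerTrees R b₀ b₁ C)
    {f : A → ℕ} (hf : ∀ a : A, (T.neighborSet a).ncard = f a + 1) :
    IsOutcome R b₀ b₁ A C f T := by
  by_cases hb₀ : b₀ ∈ C
  · have : initial R b₀ b₁ C = tourState R b₀ b₁ C T 0 := by
      rw [initial, if_pos hb₀, tourState, cutGraph_zero hT.1.1, tourPair_zero]
      simp [traversedPairs]
    rw [IsOutcome, this]
    exact reflTransGen_tourState hC hA hb hT hf tourLength_pos hb₀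
  · have hadj := adj_base_of_notMem hC hb hT hb₀
    have h1 : tourPair R b₀ b₁ T 1 = (b₁, R.rot b₁ b₀) := by
      rw [tourPair_succ, tourPair_zero, tourStep_of_adj R hadj]
    have : initial R b₀ b₁ C = tourState R b₀ b₁ C T 1 := by
      rw [initial, if_neg hb₀, tourState, h1, cutGraph_succ (Or.inl hadj), cutGraph_zero hT.1.1,
        traversedPairs_succ_of_adj hadj, tourPair_zero]
      simp [traversedPairs]
    rw [IsOutcome, this]
    refine reflTransGen_tourState hC hA hb hT hf ?_ ?_
    · refine lt_of_le_of_ne tourLength_pos fun h => ?_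
      have h2 := tourPair_tourLength (R := R) (b₀ := b₀) (b₁ := b₁) (T := T)
      rw [← h, h1] at h2
      exact hb.ne (congrArg Prod.fst h2).symm
    · rw [h1]
      exact (hC b₁ b₀ hb.symm).2 hb₀

end Follow

/-! ### Outcomes -/

theorem Step.unique {G : SimpleGraph N} {R : RibbonStructure G} {A : Set N} {f : A → ℕ}
    {s t t' : State N} (h : Step R A f s t) (h' : Step R A f s t') : t = t' := by
  cases h <;> cases h' <;> first | rfl | contradiction

theorem Stops.not_step {G : SimpleGraph N} {R : RibbonStructure G} {A : Set N} {f : A → ℕ}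
    {s t : State N} (h : Stops R A f s) : ¬ Step R A f s t := by
  intro hs
  cases hs with
  | remove h' => exact h.1 h'
  | traverse _ h' => exact h.2 h'

theorem IsOutcome.unique {G : SimpleGraph N} {R : RibbonStructure G} {b₀ b₁ : N} {A C : Set N}
    {f : A → ℕ} {T T' : SimpleGraph N} (h : IsOutcome R b₀ b₁ A C f T)
    (h' : IsOutcome R b₀ b₁ A C f T') : T = T' := by
  obtain ⟨s, hs, hfinal, rfl⟩ := h
  obtain ⟨s', hs', hfinal', rfl⟩ := h'
  have hst : ∀ {s t : State N}, Stops R A f s → Relation.ReflTransGen (Step R A f) s t → s = t := by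
    intro s t h1 h2
    rcases h2.cases_head with h2 | ⟨u, h2, -⟩
    · exact h2
    · exact absurd h2 h1.not_step
  rcases Relation.ReflTransGen.total_of_right_unique (fun _ _ _ h h' => h.unique h') hs hs'
    with h | h
  · rw [hst hfinal h]
  · rw [hst hfinal' h]

theorem exists_isOutcome [Finite N] {G : SimpleGraph N} (R : RibbonStructure G) {b₀ b₁ : N}
    (hb : G.Adj b₀ b₁) {A C : Set N} (hC : ∀ x y, G.Adj x y → (x ∈ C ↔ y ∉ C))
    (hA : A = C ∨ A = Cᶜ) {f : A → ℕ} (hf : IsHypertree G A f) :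
    ∃ T ∈ jaegerTrees R b₀ b₁ C, IsOutcome R b₀ b₁ A C f T := by
  obtain ⟨T, hT, hTf⟩ := exists_jaegerTree R hb hC hA hf
  exact ⟨T, hT, isOutcome_of_mem_jaegerTrees hC hA hb hT hTf⟩

/-- Uniqueness of the outcome identifies it with the Jaeger tree realizing `f`. Conversely, the
degrees of a Jaeger tree minus one form a hypertree with that tree as outcome. -/
theorem bernardiOutcomes_eq_jaegerTrees [Finite N] {G : SimpleGraph N} (R : RibbonStructure G)
    {b₀ b₁ : N} (hb : G.Adj b₀ b₁) {A C : Set N} (hC : ∀ x y, G.Adj x y → (x ∈ C ↔ y ∉ C))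
    (hA : A = C ∨ A = Cᶜ) : bernardiOutcomes R b₀ b₁ A C = jaegerTrees R b₀ b₁ C := by
  ext T
  constructor
  · rintro ⟨f, hf, hT⟩
    obtain ⟨T', hT', h⟩ := exists_isOutcome R hb hC hA hf
    rwa [hT.unique h]
  · intro hT
    have hf : ∀ a : A, (T.neighborSet a).ncard = ((T.neighborSet a).ncard - 1) + 1 := by
      intro a
      obtain ⟨z, hz⟩ := exists_adj_of_isSpanningTree hT.1 hb a
      have : 0 < (T.neighborSet a).ncard := (Set.ncard_pos (Set.toFinite _)).2 ⟨z, hz⟩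
      omega
    exact ⟨fun a => (T.neighborSet a).ncard - 1, ⟨T, hT.1, hf⟩,
      isOutcome_of_mem_jaegerTrees hC hA hb hT hf⟩

end RibbonBernardi

theorem theoremt {N : Type*} [Finite N] (G : SimpleGraph N) (hG : G.Connected)
    (V E : Set N) (hVE : G.IsBipartiteWith V E)
    (R : RibbonBernardi.RibbonStructure G) (b₀ b₁ : N) (hb : G.Adj b₀ b₁) :
    (∀ A ∈ ({V, E} : Set (Set N)), ∀ C ∈ ({V, E} : Set (Set N)), ∀ f : A → ℕ,
      RibbonBernardi.IsHypertree G A f →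
        ∃! T : SimpleGraph N, RibbonBernardi.IsOutcome R b₀ b₁ A C f T) ∧
    RibbonBernardi.bernardiOutcomes R b₀ b₁ E V = RibbonBernardi.jaegerTrees R b₀ b₁ V ∧
    RibbonBernardi.bernardiOutcomes R b₀ b₁ V V = RibbonBernardi.jaegerTrees R b₀ b₁ V ∧
    RibbonBernardi.bernardiOutcomes R b₀ b₁ E E = RibbonBernardi.jaegerTrees R b₀ b₁ E ∧
    RibbonBernardi.bernardiOutcomes R b₀ b₁ V E = RibbonBernardi.jaegerTrees R b₀ b₁ E := by
  have : Nontrivial N := ⟨⟨b₀, b₁, hb.ne⟩⟩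
  -- `IsBipartiteWith` does not say that the classes cover all nodes; this follows because no node
  -- of `G` is isolated.
  obtain rfl : E = Vᶜ := by
    ext x
    obtain ⟨y, hxy⟩ := hG.preconnected.exists_adj_of_nontrivial x
    refine ⟨fun hx hx' => Set.disjoint_left.1 hVE.disjoint hx' hx, fun hx => ?_⟩
    exact ((hVE.mem_of_adj hxy).resolve_left fun h => hx h.1).1
  have hV : ∀ x y, G.Adj x y → (x ∈ V ↔ y ∉ V) := by
    intro x y h
    have := hVE.mem_of_adj h
    simp only [Set.mem_compl_iff] at this
    tauto
  have hV' : ∀ x y, G.Adj x y → (x ∈ Vᶜ ↔ y ∉ Vᶜ) := by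
    intro x y h
    have := hV x y h
    simp only [Set.mem_compl_iff]
    tauto
  refine ⟨fun A hA C hC f hf => ?_,
    RibbonBernardi.bernardiOutcomes_eq_jaegerTrees R hb hV (Or.inr rfl),
    RibbonBernardi.bernardiOutcomes_eq_jaegerTrees R hb hV (Or.inl rfl),
    RibbonBernardi.bernardiOutcomes_eq_jaegerTrees R hb hV' (Or.inl rfl),
    RibbonBernardi.bernardiOutcomes_eq_jaegerTrees R hb hV' (Or.inr (compl_compl V).symm)⟩
  have hC' : ∀ x y, G.Adj x y → (x ∈ C ↔ y ∉ C) := by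
    rcases hC with rfl | rfl
    · exact hV
    · exact hV'
  have hAC : A = C ∨ A = Cᶜ := by
    rcases hA with rfl | rfl <;> rcases hC with rfl | rfl <;> simp
  obtain ⟨T, -, hT⟩ := RibbonBernardi.exists_isOutcome R hb hC' hAC hf
  exact ⟨T, hT, fun T' hT' => hT'.unique hT⟩
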